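/- All graphs are finite and simple, and a \emph{property} is an isomorphism-closed class of graphs. A property $\mathcal P$ is \emph{hereditary} if it is closed under (not necessarily induced) subgraphs, \emph{hereditary compositive} if it is hereditary and any two graphs in $\mathcal P$ are both subgraphs of some graph in $\mathcal P$, and \emph{additive} if it is closed under vertex-disjoint unions. The \emph{product} $\mathcal P_1\circ\cdots\circ\mathcal P_m$ consists of the graphs $G$ whose vertex set has a partition $V_1,\dots,V_m$ into possibly empty parts such that $G[V_i]\in\mathcal P_i$ for each $i$ with $V_i\neq\emptyset$; for $m=0$ it contains only the null graph. A graph is \emph{decomposable} if it is the join of two non-null graphs, and \emph{indecomposable} otherwise. Every graph $G$ is uniquely the join of indecomposable non-null graphs, its \emph{ind-parts}; their number is $dc(G)$. Let $\mathcal P$ be a hereditary property that contains some graph but not all graphs. A graph $G\in\mathcal P$ is \emph{$\mathcal P$-maximal} if $G+e\notin\mathcal P$ for every edge $e$ of the complement of $G$. Let $c(\mathcal P)$ be the largest $r$ with $K_r\in\mathcal P$, let $\mathcal M^*(\mathcal P)$ be the set of $\mathcal P$-maximal graphs with at least $c(\mathcal P)$ vertices, and put $dc(\mathcal P)=\min\{dc(G):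 G\in\mathcal M^*(\mathcal P)\}$. The property $\mathcal P$ is \emph{indecomposable} if $dc(\mathcal P)=1$. \textbf{Theorem.} Let $\mathcal P$ be a hereditary compositive property that contains some graph but not all graphs, and let $d=dc(\mathcal P)$. Then there are hereditary compositive properties $\mathcal P_1,\dots,\mathcal P_d$, each containing a non-null graph, with $\mathcal P=\mathcal P_1\circ\cdots\circ\mathcal P_d$, and in every such factorisation of $\mathcal P$ into $d$ factors each factor is indecomposable. If moreover $\mathcal P$ is additive, then there is such a factorisation in which every $\mathcal P_i$ is additive. -/

import Mathlib

open SimpleGraph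

/-- A graph property: an isomorphism-closed class of finite simple graphs. -/
@[ext]
structure GraphProperty where
  /-- membership of a finite graph in the property -/
  Mem : ∀ {V : Type} [Finite V], SimpleGraph V → Prop
  iso : ∀ {V W : Type} [Finite V] [Finite W] {G : SimpleGraph V} {H : SimpleGraph W},
    (G ≃g H) → Mem G → Mem H

namespace GraphProperty

/-- Some finite graph belongs to `P`. -/
def HasMember (P : GraphProperty) : Prop :=
  ∃ (V : Type) (_ : Finite V) (G : SimpleGraph V), P.Mem G

/-- Some finite graph with at least one vertex belongs to `P`. -/
def HasNonnullMember (P : GraphProperty) : Prop :=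
  ∃ (V : Type) (_ : Finite V) (G : SimpleGraph V), Nonempty V ∧ P.Mem G

/-- `P` does not contain all finite graphs. -/
def Proper (P : GraphProperty) : Prop :=
  ∃ (V : Type) (_ : Finite V) (G : SimpleGraph V), ¬ P.Mem G

/-- Closed under (not necessarily induced) subgraphs; `G ⊑ H` says that `H` has a subgraph
isomorphic to `G`. -/
def Hereditary (P : GraphProperty) : Prop :=
  ∀ {V W : Type} [Finite V] [Finite W] (G : SimpleGraph V) (H : SimpleGraph W),
    G ⊑ H → P.Mem H → P.Mem G

/-- Hereditary, and any two graphs of `P` are subgraphs of a common graph of `P`. -/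
def HereditaryCompositive (P : GraphProperty) : Prop :=
  P.Hereditary ∧
    ∀ {V W : Type} [Finite V] [Finite W] (G : SimpleGraph V) (H : SimpleGraph W),
      P.Mem G → P.Mem H →
        ∃ (U : Type) (_ : Finite U) (K : SimpleGraph U), P.Mem K ∧ G ⊑ K ∧ H ⊑ K

/-- Closed under vertex-disjoint unions. -/
def Additive (P : GraphProperty) : Prop :=
  ∀ {V W : Type} [Finite V] [Finite W] (G : SimpleGraph V) (H : SimpleGraph W),
    P.Mem G → P.Mem H → P.Mem (G ⊕g H)

/-- The product of the properties `Q i`: the graphs whose vertex set has a partition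
`(V i)`, given as the fibres of a map `f`, such that each `G[V i]` is in `Q i`; parts are
allowed to be empty. -/
def prod {ι : Type} (Q : ι → GraphProperty) : GraphProperty where
  Mem {V} _ G := ∃ f : V → ι, ∀ i, (f ⁻¹' {i}).Nonempty → (Q i).Mem (G.induce (f ⁻¹' {i}))
  iso := by
    rintro V W _ _ G H e ⟨f, hf⟩
    refine ⟨f ∘ e.symm, fun i hi => ?_⟩
    obtain ⟨w, hw⟩ := hi
    refine (Q i).iso (G := G.induce (f ⁻¹' {i})) ?_ (hf i ⟨e.symm w, hw⟩)
    exact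
      { toEquiv := e.toEquiv.subtypeEquiv (fun v => by simp)
        map_rel_iff' := by
          intro a b
          exact e.map_rel_iff' }

/-- `G` is `P`-maximal: it is in `P`, but adding any missing edge leads outside `P`. -/
def IsMaximal (P : GraphProperty) {V : Type} [Finite V] (G : SimpleGraph V) : Prop :=
  P.Mem G ∧ ∀ u v : V, u ≠ v → ¬ G.Adj u v → ¬ P.Mem (G ⊔ edge u v)

/-- `c(P)`: the largest `r` such that the complete graph `K_r` is in `P`
(meaningful if `P` is hereditary, has a member and is proper). -/
noncomputable def cliqueNumber (P : GraphProperty) : ℕ :=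
  sSup {r : ℕ | P.Mem (⊤ : SimpleGraph (Fin r))}

/-- `M*(P)`: the `P`-maximal graphs with at least `c(P)` vertices. -/
def IsMaximalStar (P : GraphProperty) {V : Type} [Finite V] (G : SimpleGraph V) : Prop :=
  P.IsMaximal G ∧ P.cliqueNumber ≤ Nat.card V

end GraphProperty

/-- `G` is the join of two non-null graphs, on vertex sets `A` and `Aᶜ`. -/
def GraphDecomposable {V : Type} (G : SimpleGraph V) : Prop :=
  ∃ A : Set V, A.Nonempty ∧ Aᶜ.Nonempty ∧ ∀ u ∈ A, ∀ v ∈ Aᶜ, G.Adj u v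

/-- `S` is the vertex set of an ind-part of `G`, i.e. of an indecomposable non-null graph
occurring in the expression of `G` as a join of such graphs. -/
def IsIndPart {V : Type} (G : SimpleGraph V) (S : Set V) : Prop :=
  S.Nonempty ∧ (∀ u ∈ S, ∀ v ∈ Sᶜ, G.Adj u v) ∧ ¬ GraphDecomposable (G.induce S)

/-- `dc(G)`: the number of ind-parts of `G`. -/
noncomputable def graphDc {V : Type} (G : SimpleGraph V) : ℕ :=
  Nat.card {S : Set V // IsIndPart G S}

namespace GraphProperty

/-- `dc(P)`: the minimum of `dc(G)` over all `G ∈ M*(P)`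
(`M*(P)` is nonempty if `P` is hereditary, has a member and is proper). -/
noncomputable def dc (P : GraphProperty) : ℕ :=
  sInf {k : ℕ | ∃ (V : Type) (_ : Finite V) (G : SimpleGraph V),
    P.IsMaximalStar G ∧ graphDc G = k}

/-- `P` is indecomposable. -/
def Indecomposable (P : GraphProperty) : Prop :=
  P.dc = 1

end GraphProperty

namespace GraphProperty

/-! The ind-parts of a graph are the components of its complement, so `dc` counts components.
Existence. A hereditary compositive property with a non-null member is the age of a graph `H`,
usually infinite, obtained as an ultraproduct of its members. The age of a join is the product of
the ages of its parts, so it suffices to write the property as the age of a join of `d` non-null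
graphs. By Zorn's lemma `H` may be taken edge-maximal for its age. Suppose a join of `k < d` parts
is given. If some part meets several components of the complement, it splits. Otherwise a new vertex
can be joined to `H` without changing the age (`containsAge_cone`): a maximal graph extending a
large finite piece of `H` has at least `d` ind-parts, the part structure of `H` lets a prescribed
finite set meet at most `k` of them, and a vertex of a missed ind-part plays the new vertex.
Indecomposability. A graph in `M*` of a product is the join of graphs in `M*` of the factors, so
`dc` is superadditive (`sum_dc_le_dc_prod`). With `d` factors, each of `dc` at least 1, all these
values equal 1. Additivity. If the property is additive, infinitely many disjoint copies of `H`
still have their finite subgraphs in it. Compactness partitions these copies along a given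
factorisation, and an ultrafilter on the copies makes the partition uniform; the parts then generate
additive factors. -/

theorem eq_of_mem_iff {P Q : GraphProperty}
    (h : ∀ {V : Type} [Finite V] (G : SimpleGraph V), P.Mem G ↔ Q.Mem G) : P = Q := by
  apply GraphProperty.ext
  funext V _ G
  exact propext (h G)

theorem mem_iff_of_eq {P Q : GraphProperty} (h : P = Q) {V : Type} [Finite V]
    (G : SimpleGraph V) : P.Mem G ↔ Q.Mem G := by
  rw [h]

/-! ### Hereditary properties and their clique number -/

theorem Hereditary.mem_of_map {P : GraphProperty} (hP : P.Hereditary) {V W : Type} [Finite V]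
    [Finite W] {G : SimpleGraph V} {H : SimpleGraph W} (hH : P.Mem H) (φ : V → W)
    (hφ : Function.Injective φ) (hadj : ∀ a b, G.Adj a b → H.Adj (φ a) (φ b)) : P.Mem G :=
  hP G H ⟨⟨⟨φ, fun {a b} => hadj a b⟩, hφ⟩⟩ hH

theorem Hereditary.mem_of_le {P : GraphProperty} (hP : P.Hereditary) {V : Type} [Finite V]
    {G H : SimpleGraph V} (hH : P.Mem H) (h : G ≤ H) : P.Mem G :=
  hP G H (.of_le h) hH

theorem HasNonnullMember.hasMember {P : GraphProperty} (h : P.HasNonnullMember) : P.HasMember := by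
  obtain ⟨V, _, G, _, hG⟩ := h
  exact ⟨V, _, G, hG⟩

theorem Hereditary.mem_of_isEmpty {P : GraphProperty} (hP : P.Hereditary) (hne : P.HasMember)
    {V : Type} [Finite V] [IsEmpty V] (G : SimpleGraph V) : P.Mem G := by
  obtain ⟨W, _, H, hH⟩ := hne
  exact hP G H .of_isEmpty hH

theorem Hereditary.mem_of_top_card_le {P : GraphProperty} (hP : P.Hereditary) {n : ℕ}
    (hn : P.Mem (⊤ : SimpleGraph (Fin n))) {V : Type} [Finite V] (G : SimpleGraph V)
    (hV : Nat.card V ≤ n) : P.Mem G := by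
  have e := Finite.equivFin V
  refine hP.mem_of_map hn (fun v => Fin.castLE hV (e v)) ?_ ?_
  · exact (Fin.castLE_injective hV).comp e.injective
  · intro a b hab
    rw [top_adj]
    exact fun h => hab.ne (e.injective (Fin.castLE_injective hV h))

theorem Hereditary.bddAbove_top {P : GraphProperty} (hP : P.Hereditary) (hproper : P.Proper) :
    BddAbove {r : ℕ | P.Mem (⊤ : SimpleGraph (Fin r))} := by
  obtain ⟨V, _, G, hG⟩ := hproper
  refine ⟨Nat.card V, fun r hr => ?_⟩
  by_contra h
  exact hG (hP.mem_of_top_card_le hr G (by omega))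

theorem Hereditary.card_le_cliqueNumber {P : GraphProperty} (hP : P.Hereditary)
    (hproper : P.Proper) {V : Type} [Finite V] (h : P.Mem (⊤ : SimpleGraph V)) :
    Nat.card V ≤ P.cliqueNumber := by
  refine le_csSup (hP.bddAbove_top hproper) ?_
  have e := Finite.equivFin V
  exact P.iso (Iso.completeGraph e) h

theorem Hereditary.mem_top_cliqueNumber {P : GraphProperty} (hP : P.Hereditary)
    (hne : P.HasMember) (hproper : P.Proper) :
    P.Mem (⊤ : SimpleGraph (Fin P.cliqueNumber)) :=
  Nat.sSup_mem ⟨0, hP.mem_of_isEmpty hne _⟩ (hP.bddAbove_top hproper)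

theorem Hereditary.mem_of_card_le {P : GraphProperty} (hP : P.Hereditary) (hne : P.HasMember)
    (hproper : P.Proper) {V : Type} [Finite V] (G : SimpleGraph V)
    (hV : Nat.card V ≤ P.cliqueNumber) : P.Mem G :=
  hP.mem_of_top_card_le (hP.mem_top_cliqueNumber hne hproper) G hV

theorem Hereditary.mem_of_card_le_one {P : GraphProperty} (hP : P.Hereditary)
    (hne : P.HasNonnullMember) {V : Type} [Finite V] (G : SimpleGraph V) (hV : Nat.card V ≤ 1) :
    P.Mem G := by
  obtain ⟨W, _, H, ⟨w⟩, hH⟩ := hne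
  have : Subsingleton V := Finite.card_le_one_iff_subsingleton.1 hV
  exact hP.mem_of_map hH (fun _ => w) (Function.injective_of_subsingleton _)
    fun a b hab => (hab.ne (Subsingleton.elim a b)).elim

theorem Hereditary.one_le_cliqueNumber {P : GraphProperty} (hP : P.Hereditary)
    (hne : P.HasNonnullMember) (hproper : P.Proper) : 1 ≤ P.cliqueNumber := by
  simpa using hP.card_le_cliqueNumber hproper
    (hP.mem_of_card_le_one hne (⊤ : SimpleGraph (Fin 1)) (by simp))

theorem isMaximalStar_top {P : GraphProperty} (hP : P.Hereditary)
    (hne : P.HasMember) (hproper : P.Proper) :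
    P.IsMaximalStar (⊤ : SimpleGraph (Fin P.cliqueNumber)) :=
  ⟨⟨hP.mem_top_cliqueNumber hne hproper, fun _ _ huv h => (h huv).elim⟩, by simp⟩

theorem exists_graphDc_eq_dc {P : GraphProperty} (hP : P.Hereditary)
    (hne : P.HasMember) (hproper : P.Proper) :
    ∃ (V : Type) (_ : Finite V) (G : SimpleGraph V), P.IsMaximalStar G ∧ graphDc G = P.dc :=
  Nat.sInf_mem
    (s := {k : ℕ | ∃ (V : Type) (_ : Finite V) (G : SimpleGraph V),
      P.IsMaximalStar G ∧ graphDc G = k})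
    ⟨_, _, _, _, isMaximalStar_top hP hne hproper, rfl⟩

theorem dc_le {P : GraphProperty} {V : Type} [Finite V] {G : SimpleGraph V}
    (hG : P.IsMaximalStar G) : P.dc ≤ graphDc G :=
  Nat.sInf_le ⟨V, _, G, hG, rfl⟩

end GraphProperty

/-! ### Ind-parts and connected components of the complement -/

/-- A splitting of the component into a join would be crossed by no complement edge, against
connectedness. -/
theorem isIndPart_supp {V : Type} {G : SimpleGraph V} (c : Gᶜ.ConnectedComponent) :
    IsIndPart G c.supp := by
  refine ⟨c.nonempty_supp, fun u hu v hv => ?_, ?_⟩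
  · by_contra h
    have huv : u ≠ v := fun e => hv (e ▸ hu)
    exact hv ((c.mem_supp_congr_adj ((compl_adj _ _ _).2 ⟨huv, h⟩)).1 hu)
  · rintro ⟨A, ⟨⟨a, ha⟩, haA⟩, ⟨⟨b, hb⟩, hbA⟩, hAB⟩
    have hab : Gᶜ.Reachable a b := by
      rw [← ConnectedComponent.eq, (ConnectedComponent.mem_supp_iff _ _).1 ha,
        (ConnectedComponent.mem_supp_iff _ _).1 hb]
    have key : ∀ x, Gᶜ.Reachable a x → ∀ hx : x ∈ c.supp, (⟨x, hx⟩ : c.supp) ∈ A := by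
      intro x hx
      rw [reachable_iff_reflTransGen] at hx
      induction hx with
      | refl => exact fun _ => haA
      | @tail y z _ hyz ih =>
        intro hz
        have hy : y ∈ c.supp := (c.mem_supp_congr_adj hyz).2 hz
        by_contra hzA
        exact ((compl_adj _ _ _).1 hyz).2 (hAB _ (ih hy) _ hzA)
    exact hbA (key b hab hb)

theorem IsIndPart.exists_supp_eq {V : Type} {G : SimpleGraph V} {S : Set V} (hS : IsIndPart G S) :
    ∃ c : Gᶜ.ConnectedComponent, c.supp = S := by
  obtain ⟨⟨a, ha⟩, hjoin, hind⟩ := hS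
  have closed : ∀ x y, Gᶜ.Adj x y → x ∈ S → y ∈ S := by
    intro x y hxy hx
    by_contra hy
    exact ((compl_adj _ _ _).1 hxy).2 (hjoin x hx y hy)
  refine ⟨Gᶜ.connectedComponentMk a, Set.Subset.antisymm ?_ ?_⟩
  · intro x hx
    have hax : Gᶜ.Reachable a x := (ConnectedComponent.eq.1 hx).symm
    clear hx
    rw [reachable_iff_reflTransGen] at hax
    induction hax with
    | refl => exact ha
    | tail _ hyz ih => exact closed _ _ hyz ih
  · intro x hx
    by_contra hxc
    refine hind ⟨{y | Gᶜ.Reachable a y}, ⟨⟨a, ha⟩, Reachable.refl _⟩, ⟨⟨x, hx⟩, ?_⟩, ?_⟩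
    · exact fun h => hxc (ConnectedComponent.eq.2 h.symm)
    · intro u hu v hv
      by_contra huv
      have hne : u.1 ≠ v.1 := fun e => hv (Subtype.ext e ▸ hu)
      exact hv (hu.trans (Adj.reachable ((compl_adj _ _ _).2 ⟨hne, huv⟩)))

theorem graphDc_eq_card_connectedComponent {V : Type} (G : SimpleGraph V) :
    graphDc G = Nat.card Gᶜ.ConnectedComponent := by
  refine (Nat.card_congr (Equiv.ofBijective
    (fun c : Gᶜ.ConnectedComponent => (⟨c.supp, isIndPart_supp c⟩ : {S // IsIndPart G S}))
    ⟨fun c d h => ConnectedComponent.supp_injective (congrArg Subtype.val h), ?_⟩)).symm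
  rintro ⟨S, hS⟩
  obtain ⟨c, rfl⟩ := hS.exists_supp_eq
  exact ⟨c, rfl⟩

theorem one_le_graphDc {V : Type} [Finite V] [Nonempty V] (G : SimpleGraph V) :
    1 ≤ graphDc G := by
  rw [graphDc_eq_card_connectedComponent]
  exact Nat.card_pos

/-- If `G` is the join of the subgraphs induced by the fibres of `f`, then the ind-parts of these
subgraphs are ind-parts of `G`. -/
theorem sum_graphDc_induce_le {V ι : Type} [Finite V] [Fintype ι] (G : SimpleGraph V) (f : V → ι)
    (hf : ∀ u v, f u ≠ f v → G.Adj u v) :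
    ∑ i, graphDc (G.induce (f ⁻¹' {i})) ≤ graphDc G := by
  simp only [graphDc_eq_card_connectedComponent]
  rw [← Nat.card_sigma]
  -- Vertices in different fibres are adjacent in `G`, so a walk in the complement never leaves its
  -- fibre.
  have key : ∀ x y, Gᶜ.Reachable x y → ∀ i (hx : f x = i), ∃ hy : f y = i,
      (G.induce (f ⁻¹' {i}))ᶜ.Reachable ⟨x, hx⟩ ⟨y, hy⟩ := by
    intro x y hxy i hx
    rw [reachable_iff_reflTransGen] at hxy
    induction hxy with
    | refl => exact ⟨hx, Reachable.refl _⟩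
    | @tail y z _ hyz ih =>
      obtain ⟨hy, hr⟩ := ih
      rw [compl_adj] at hyz
      have hz : f z = i := by
        by_contra hz
        exact hyz.2 (hf y z (by rw [hy]; exact fun e => hz e.symm))
      refine ⟨hz, hr.trans (Adj.reachable ?_)⟩
      rw [compl_adj]
      exact ⟨fun e => hyz.1 (congrArg Subtype.val e), hyz.2⟩
  refine Nat.card_le_card_of_injective
    (fun p : Σ i, (G.induce (f ⁻¹' {i}))ᶜ.ConnectedComponent =>
      Gᶜ.connectedComponentMk p.2.out.1) ?_
  rintro ⟨i, c⟩ ⟨j, d⟩ h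
  obtain ⟨hy, hr⟩ := key _ _ (ConnectedComponent.eq.1 h) i c.out.2
  obtain rfl : i = j := hy.symm.trans d.out.2
  congr 1
  rw [← Quot.out_eq c, ← Quot.out_eq d]
  exact ConnectedComponent.eq.2 hr

namespace GraphProperty

/-! ### Factorisations with a maximal number of factors -/

theorem proper_of_prod {ι : Type} {Q : ι → GraphProperty} (h : (prod Q).Proper) (i : ι) :
    (Q i).Proper := by
  by_contra hi
  obtain ⟨V, _, G, hG⟩ := h
  refine hG ⟨fun _ => i, fun j ⟨v, hv⟩ => ?_⟩
  obtain rfl : i = j := hv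
  by_contra hj
  exact hi ⟨_, _, _, hj⟩

theorem prod_hereditary {ι : Type} {Q : ι → GraphProperty} (hQ : ∀ i, (Q i).Hereditary) :
    (prod Q).Hereditary := by
  rintro V W _ _ G H ⟨φ⟩ ⟨f, hf⟩
  refine ⟨f ∘ φ, fun i ⟨v, hv⟩ => ?_⟩
  refine Hereditary.mem_of_map (hQ i) (hf i ⟨φ v, hv⟩) (fun x => ⟨φ x.1, x.2⟩) ?_ ?_
  · exact fun x y h => Subtype.ext (φ.injective (congrArg Subtype.val h))
  · exact fun x y h => φ.toHom.map_adj h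

theorem prod_mem_of_forall {ι : Type} {Q : ι → GraphProperty} {V : Type} [Finite V]
    {G : SimpleGraph V} (f : V → ι) (hf : ∀ i, (Q i).Mem (G.induce (f ⁻¹' {i}))) :
    (prod Q).Mem G :=
  ⟨f, fun i _ => hf i⟩

theorem exists_forall_mem_of_prod {ι : Type} {Q : ι → GraphProperty}
    (hQ : ∀ i, (Q i).Hereditary) (hne : ∀ i, (Q i).HasMember) {V : Type} [Finite V]
    {G : SimpleGraph V} (hG : (prod Q).Mem G) :
    ∃ f : V → ι, ∀ i, (Q i).Mem (G.induce (f ⁻¹' {i})) := by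
  obtain ⟨f, hf⟩ := hG
  refine ⟨f, fun i => ?_⟩
  by_cases h : (f ⁻¹' {i}).Nonempty
  · exact hf i h
  · have : IsEmpty (f ⁻¹' {i}) := Set.isEmpty_coe_sort.2 (Set.not_nonempty_iff_eq_empty.1 h)
    exact Hereditary.mem_of_isEmpty (hQ i) (hne i) _

/-- A largest clique from each factor, all joined together, is a clique in the product. -/
theorem sum_cliqueNumber_le {ι : Type} [Fintype ι] {Q : ι → GraphProperty}
    (hQ : ∀ i, (Q i).Hereditary) (hne : ∀ i, (Q i).HasMember) (hproper : (prod Q).Proper) :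
    ∑ i, (Q i).cliqueNumber ≤ (prod Q).cliqueNumber := by
  have h : (prod Q).Mem (⊤ : SimpleGraph (Σ i, Fin (Q i).cliqueNumber)) := by
    refine prod_mem_of_forall Sigma.fst fun i => ?_
    refine Hereditary.mem_of_card_le (hQ i) (hne i) (proper_of_prod hproper i) _ ?_
    refine (Nat.card_congr
      (Equiv.sigmaSubtype (β := fun i => Fin (Q i).cliqueNumber) i)).trans_le ?_
    simp
  simpa using Hereditary.card_le_cliqueNumber (prod_hereditary hQ) hproper h

/-! ### Maximal graphs of a product -/

section Maximal

variable {ι : Type} {Q : ι → GraphProperty} {V : Type} [Finite V] {G : SimpleGraph V} {f : V → ι}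

/-- An edge between two fibres is invisible to every induced part, so adding it stays in the
product. -/
theorem IsMaximal.adj_of_ne (hQ : ∀ i, (Q i).Hereditary)
    (hG : (prod Q).IsMaximal G) (hf : ∀ i, (Q i).Mem (G.induce (f ⁻¹' {i}))) {u v : V}
    (huv : f u ≠ f v) : G.Adj u v := by
  by_contra h
  refine hG.2 u v (fun e => huv (congrArg f e)) h (prod_mem_of_forall f fun i => ?_)
  refine Hereditary.mem_of_le (hQ i) (hf i) fun x y hxy => ?_
  have hx : f x = i := x.2
  have hy : f y = i := y.2
  rw [comap_adj, sup_adj, edge_adj] at hxy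
  rcases hxy with hxy | ⟨⟨h1, h2⟩ | ⟨h1, h2⟩, -⟩
  · exact hxy
  · exact (huv (by rw [← h1, ← h2]; exact hx.trans hy.symm)).elim
  · exact (huv (by rw [← h1, ← h2]; exact hy.trans hx.symm)).elim

theorem IsMaximal.induce_fibre (hQ : ∀ i, (Q i).Hereditary)
    (hG : (prod Q).IsMaximal G) (hf : ∀ i, (Q i).Mem (G.induce (f ⁻¹' {i}))) (i : ι) :
    (Q i).IsMaximal (G.induce (f ⁻¹' {i})) := by
  refine ⟨hf i, fun u v huv hnadj hmem => ?_⟩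
  refine hG.2 u v (fun e => huv (Subtype.ext e)) hnadj (prod_mem_of_forall f fun j => ?_)
  by_cases hj : j = i
  · subst hj
    refine Hereditary.mem_of_le (hQ j) hmem fun x y hxy => ?_
    simpa only [comap_adj, sup_adj, edge_adj, Function.Embedding.subtype_apply, Subtype.ext_iff,
      ne_eq] using hxy
  · refine Hereditary.mem_of_le (hQ j) (hf j) fun x y hxy => ?_
    have hx : f x = j := x.2
    have hu : f u = i := u.2
    have hv : f v = i := v.2
    rw [comap_adj, sup_adj, edge_adj] at hxy
    rcases hxy with hxy | ⟨⟨h1, -⟩ | ⟨h1, -⟩, -⟩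
    · exact hxy
    · exact (hj (by rw [← hx, ← hu, ← h1]; rfl)).elim
    · exact (hj (by rw [← hx, ← hv, ← h1]; rfl)).elim

/-- If fibre `i` were too small, counting would make some fibre `j` larger than the clique number of
`Q j`, hence not complete. Moving an endpoint `v` of a missing edge `uv` from `j` to `i` is
harmless, since fibre `i` still has at most `c(Q i)` vertices; now `uv` runs between fibres and can
be added, against maximality. -/
theorem IsMaximalStar.cliqueNumber_le_card_fibre [Fintype ι] (hQ : ∀ i, (Q i).Hereditary)
    (hne : ∀ i, (Q i).HasMember) (hproper : (prod Q).Proper) (hG : (prod Q).IsMaximalStar G)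
    (hf : ∀ i, (Q i).Mem (G.induce (f ⁻¹' {i}))) (i : ι) :
    (Q i).cliqueNumber ≤ Nat.card (f ⁻¹' {i}) := by
  classical
  by_contra! hi
  have hcard : ∑ j, Nat.card (f ⁻¹' {j}) = Nat.card V := by
    rw [← Nat.card_sigma]
    exact Nat.card_congr (Equiv.sigmaFiberEquiv f)
  obtain ⟨j, hj⟩ : ∃ j, (Q j).cliqueNumber < Nat.card (f ⁻¹' {j}) := by
    by_contra! h
    have h1 := Finset.sum_lt_sum (fun j _ => h j) ⟨i, Finset.mem_univ i, hi⟩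
    have h2 := sum_cliqueNumber_le hQ hne hproper
    have h3 := hG.2
    omega
  have hji : j ≠ i := by
    rintro rfl
    omega
  obtain ⟨u, v, huv, hnadj⟩ : ∃ u v : f ⁻¹' {j}, u ≠ v ∧ ¬ G.Adj u v := by
    by_contra! h
    have htop : G.induce (f ⁻¹' {j}) = ⊤ := by
      rw [eq_top_iff]
      exact fun x y hxy => h x y hxy
    have hm := hf j
    rw [htop] at hm
    have := Hereditary.card_le_cliqueNumber (hQ j) (proper_of_prod hproper j) hm
    omega
  refine hG.1.2 u v (fun e => huv (Subtype.ext e)) hnadj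
    (prod_mem_of_forall (Function.update f v i) fun k => ?_)
  by_cases hk : k = i
  · subst hk
    refine Hereditary.mem_of_card_le (hQ k) (hne k) (proper_of_prod hproper k) _ ?_
    have hsub : Function.update f v k ⁻¹' {k} ⊆ insert v.1 (f ⁻¹' {k}) := by
      intro x hx
      by_cases hxv : x = v
      · exact Or.inl hxv
      · right
        simpa [Function.update_of_ne hxv] using hx
    have h1 := Set.ncard_le_ncard hsub (Set.toFinite _)
    have h2 := Set.ncard_insert_le v.1 (f ⁻¹' {k})
    rw [← Nat.card_coe_set_eq, ← Nat.card_coe_set_eq] at h1 h2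
    omega
  · have hne' : ∀ x : (Function.update f v i ⁻¹' {k} : Set V), x.1 ≠ v.1 := by
      rintro ⟨x, hx⟩ rfl
      simp only [Set.mem_preimage, Function.update_self, Set.mem_singleton_iff] at hx
      exact hk hx.symm
    have hfx : ∀ x : (Function.update f v i ⁻¹' {k} : Set V), f x.1 = k := by
      intro x
      have := x.2
      rwa [Set.mem_preimage, Function.update_of_ne (hne' x)] at this
    refine Hereditary.mem_of_map (hQ k) (hf k) (fun x => ⟨x.1, hfx x⟩) ?_ ?_
    · exact fun x y h => Subtype.ext (Subtype.mk.inj h)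
    · intro x y hxy
      rw [comap_adj, sup_adj, edge_adj] at hxy
      rcases hxy with hxy | ⟨⟨-, h⟩ | ⟨h, -⟩, -⟩
      · exact hxy
      · exact (hne' y h).elim
      · exact (hne' x h).elim

end Maximal

theorem one_le_dc {P : GraphProperty} (hP : P.Hereditary) (hne : P.HasNonnullMember)
    (hproper : P.Proper) : 1 ≤ P.dc := by
  obtain ⟨V, _, G, hG, hdc⟩ := exists_graphDc_eq_dc hP hne.hasMember hproper
  have : Nonempty V := by
    refine (Nat.card_pos_iff.1 ?_).1
    exact (hP.one_le_cliqueNumber hne hproper).trans hG.2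
  exact hdc ▸ one_le_graphDc G

/-- A graph of `M*` attaining `dc` of the product is the join of its fibres, each in `M*` of its
factor. -/
theorem sum_dc_le_dc_prod {ι : Type} [Fintype ι] {Q : ι → GraphProperty}
    (hQ : ∀ i, (Q i).Hereditary) (hne : ∀ i, (Q i).HasMember) (hproper : (prod Q).Proper) :
    ∑ i, (Q i).dc ≤ (prod Q).dc := by
  have hmem : (prod Q).HasMember :=
    ⟨Empty, inferInstance, ⊥, fun x => x.elim, fun i ⟨x, _⟩ => x.elim⟩
  obtain ⟨V, _, G, hG, hdc⟩ := exists_graphDc_eq_dc (prod_hereditary hQ) hmem hproper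
  obtain ⟨f, hf⟩ := exists_forall_mem_of_prod hQ hne hG.1.1
  rw [← hdc]
  refine le_trans (Finset.sum_le_sum fun i _ => dc_le (P := Q i) ⟨?_, ?_⟩)
    (sum_graphDc_induce_le G f fun u v => hG.1.adj_of_ne hQ hf)
  · exact hG.1.induce_fibre hQ hf i
  · exact hG.cliqueNumber_le_card_fibre hQ hne hproper hf i

theorem indecomposable_of_prod {P : GraphProperty} (hproper : P.Proper)
    {Q : Fin P.dc → GraphProperty} (h : P = prod Q)
    (hQ : ∀ i, (Q i).HereditaryCompositive ∧ (Q i).HasNonnullMember) (i : Fin P.dc) :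
    (Q i).Indecomposable := by
  have hproper' : (prod Q).Proper := h ▸ hproper
  have h1 : ∀ i, 1 ≤ (Q i).dc := fun i =>
    one_le_dc (hQ i).1.1 (hQ i).2 (proper_of_prod hproper' i)
  have h2 := sum_dc_le_dc_prod (fun i => (hQ i).1.1) (fun i => (hQ i).2.hasMember) hproper'
  have h3 : ∑ i, (Q i).dc ≤ ∑ _i : Fin P.dc, 1 := by
    rw [← h] at h2
    simpa using h2
  exact ((Finset.sum_eq_sum_iff_of_le fun i _ => h1 i).1
    (le_antisymm (Finset.sum_le_sum fun i _ => h1 i) h3) i (Finset.mem_univ i)).symm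

end GraphProperty

namespace GraphProperty

/-! ### The age of a graph -/

/-- The finite graphs contained in the (possibly infinite) graph `H`. -/
def age {V : Type} (H : SimpleGraph V) : GraphProperty where
  Mem G := G ⊑ H
  iso e h := IsContained.trans ⟨e.symm.toCopy⟩ h

theorem age_hereditaryCompositive {V : Type} (H : SimpleGraph V) :
    (age H).HereditaryCompositive := by
  refine ⟨fun G K h hK => h.trans hK, ?_⟩
  rintro A B _ _ G K ⟨φ⟩ ⟨ψ⟩
  refine ⟨(Set.range φ ∪ Set.range ψ : Set V), inferInstance, H.induce _, ⟨Copy.induce _ _⟩,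
    ⟨⟨⟨fun a => ⟨φ a, Or.inl ⟨a, rfl⟩⟩, fun h => φ.toHom.map_adj h⟩, ?_⟩⟩,
    ⟨⟨⟨fun a => ⟨ψ a, Or.inr ⟨a, rfl⟩⟩, fun h => ψ.toHom.map_adj h⟩, ?_⟩⟩⟩
  · exact fun x y h => φ.injective (congrArg Subtype.val h)
  · exact fun x y h => ψ.injective (congrArg Subtype.val h)

theorem age_hasNonnullMember {V : Type} [Nonempty V] (H : SimpleGraph V) :
    (age H).HasNonnullMember := by
  obtain ⟨v⟩ := ‹Nonempty V›
  exact ⟨Unit, inferInstance, ⊥, inferInstance,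
    ⟨Copy.bot ⟨fun _ => v, Function.injective_of_subsingleton _⟩⟩⟩

/-- The age of a join is the product of the ages of its parts. -/
theorem age_eq_prod {V ι : Type} (H : SimpleGraph V) (f : V → ι)
    (hf : ∀ u v, f u ≠ f v → H.Adj u v) :
    age H = prod fun i => age (H.induce (f ⁻¹' {i})) := by
  apply eq_of_mem_iff
  intro W _ G
  constructor
  · rintro ⟨φ⟩
    refine ⟨f ∘ φ, fun i _ => ⟨⟨⟨fun x => ⟨φ x.1, x.2⟩, fun h => φ.toHom.map_adj h⟩, ?_⟩⟩⟩
    exact fun x y h => Subtype.ext (φ.injective (congrArg Subtype.val h))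
  · rintro ⟨g, hg⟩
    have c : ∀ i, (g ⁻¹' {i}).Nonempty →
        Copy (G.induce (g ⁻¹' {i})) (H.induce (f ⁻¹' {i})) := fun i hi => (hg i hi).some
    -- The copies of the separate parts are glued; edges between parts are preserved because `H` is
    -- a join, and the images lie in disjoint fibres.
    let F : W → V := fun w => (c (g w) ⟨w, rfl⟩ ⟨w, rfl⟩).1
    have hF : ∀ w i (h : g w = i), F w = (c i ⟨w, h⟩ ⟨w, h⟩).1 := by
      rintro w i rfl
      rfl
    have hfF : ∀ w, f (F w) = g w := fun w => (c (g w) ⟨w, rfl⟩ ⟨w, rfl⟩).2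
    refine ⟨⟨⟨F, fun {x y} hxy => ?_⟩, fun x y hxy => ?_⟩⟩
    · by_cases h : g x = g y
      · rw [hF x _ h, hF y _ rfl]
        exact (c (g y) ⟨y, rfl⟩).toHom.map_adj
          (show (G.induce (g ⁻¹' {g y})).Adj ⟨x, h⟩ ⟨y, rfl⟩ from hxy)
      · exact hf _ _ (by rwa [hfF, hfF])
    · change F x = F y at hxy
      have h : g x = g y := by rw [← hfF, ← hfF, hxy]
      rw [hF x _ h, hF y _ rfl] at hxy
      exact congrArg Subtype.val ((c (g y) ⟨y, rfl⟩).injective (Subtype.ext hxy))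

/-- All finite graphs contained in `H` belong to `P`. -/
def ContainsAge (P : GraphProperty) {V : Type} (H : SimpleGraph V) : Prop :=
  ∀ (W : Type) (_ : Finite W) (G : SimpleGraph W), G ⊑ H → P.Mem G

theorem containsAge_age {V : Type} (H : SimpleGraph V) : (age H).ContainsAge H :=
  fun _ _ _ h => h

theorem ContainsAge.age_eq {V W : Type} {H : SimpleGraph V} {K : SimpleGraph W}
    (h : (age H).ContainsAge K) (hHK : H ⊑ K) : age H = age K :=
  eq_of_mem_iff fun _ => ⟨fun hG => IsContained.trans hG hHK, fun hG => h _ _ _ hG⟩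

/-! ### Realising a property as the age of an infinite graph -/

section Ultraproduct

variable {I : Type} (V : I → Type) (G : ∀ i, SimpleGraph (V i)) (U : Ultrafilter I)

/-- The ultraproduct of the graphs `G i` along `U`. -/
def ultraproduct : SimpleGraph ((U : Filter I).Product V) where
  Adj x y := ∀ᶠ i in (U : Filter I), (G i).Adj (x.out i) (y.out i)
  symm := ⟨fun _ _ h => h.mono fun _ h => h.symm⟩
  loopless := ⟨fun _ h => by
    obtain ⟨i, hi⟩ := h.exists
    exact hi.ne rfl⟩

/-- For finite `K`, being a copy amounts to finitely many conditions on representatives, each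
holding for almost all indices. -/
theorem eventually_isContained_of_ultraproduct {W : Type} [Finite W] {K : SimpleGraph W}
    (h : K ⊑ ultraproduct V G U) : ∀ᶠ i in (U : Filter I), K ⊑ G i := by
  obtain ⟨φ⟩ := h
  have h1 : ∀ᶠ i in (U : Filter I), ∀ a b, K.Adj a b → (G i).Adj ((φ a).out i) ((φ b).out i) := by
    rw [Filter.eventually_all]
    intro a
    rw [Filter.eventually_all]
    intro b
    by_cases hab : K.Adj a b
    · exact (φ.toHom.map_adj hab : (ultraproduct V G U).Adj (φ a) (φ b)).mono fun _ h _ => h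
    · exact .of_forall fun _ h => (hab h).elim
  have h2 : ∀ᶠ i in (U : Filter I), ∀ a b, (φ a).out i = (φ b).out i → a = b := by
    rw [Filter.eventually_all]
    intro a
    rw [Filter.eventually_all]
    intro b
    by_cases hab : a = b
    · exact .of_forall fun _ _ => hab
    · refine (Ultrafilter.eventually_not.2 fun h => hab ?_).mono fun _ h h' => (h h').elim
      apply φ.injective
      change φ a = φ b
      rw [← Quotient.out_eq (φ a), ← Quotient.out_eq (φ b)]
      exact Quotient.sound h
  filter_upwards [h1, h2] with i h1 h2
  exact ⟨⟨⟨fun a => (φ a).out i, fun {a b} => h1 a b⟩, fun a b => h2 a b⟩⟩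

theorem isContained_ultraproduct [∀ i, Nonempty (V i)] {W : Type} {K : SimpleGraph W}
    (h : ∀ᶠ i in (U : Filter I), K ⊑ G i) : K ⊑ ultraproduct V G U := by
  classical
  let F : W → ∀ i, V i := fun w i =>
    if hi : K ⊑ G i then hi.some w else Classical.arbitrary _
  have hF : ∀ i (hi : K ⊑ G i) w, F w i = hi.some w := fun i hi w => dif_pos hi
  let s := (U : Filter I).productSetoid V
  have hout : ∀ w, ∀ᶠ i in (U : Filter I), (Quotient.mk s (F w)).out i = F w i :=
    fun w => Quotient.mk_out (s := s) (F w)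
  refine ⟨⟨⟨fun w => Quotient.mk s (F w), fun {a b} hab => ?_⟩, fun a b hab => ?_⟩⟩
  · change ∀ᶠ i in (U : Filter I), _
    filter_upwards [h, hout a, hout b] with i hi ha hb
    rw [ha, hb, hF i hi, hF i hi]
    exact hi.some.toHom.map_adj hab
  · have hab' : ∀ᶠ i in (U : Filter I), F a i = F b i := Quotient.exact hab
    obtain ⟨i, hi, hi'⟩ := (h.and hab').exists
    rw [hF i hi, hF i hi] at hi'
    exact hi.some.injective hi'

end Ultraproduct

/-- The non-null members of `P`, up to isomorphism. -/
structure NonnullMember (P : GraphProperty) where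
  /-- one less than the number of vertices -/
  pred : ℕ
  /-- the graph -/
  graph : SimpleGraph (Fin (pred + 1))
  mem : P.Mem graph

instance (P : GraphProperty) : Preorder P.NonnullMember where
  le i j := i.graph ⊑ j.graph
  le_refl _ := .rfl
  le_trans _ _ _ := .trans

theorem exists_nonnullMember_iso {P : GraphProperty} {W : Type} [Finite W] [Nonempty W]
    {K : SimpleGraph W} (hK : P.Mem K) : ∃ i : P.NonnullMember, Nonempty (K ≃g i.graph) := by
  obtain ⟨n, hn⟩ : ∃ n, Nat.card W = n + 1 := Nat.exists_eq_succ_of_ne_zero Nat.card_pos.ne'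
  let e : W ≃ Fin (n + 1) := Finite.equivFinOfCardEq hn
  exact ⟨⟨n, K.map e.toEmbedding, P.iso (Iso.map e K) hK⟩, ⟨Iso.map e K⟩⟩

/-- Every hereditary compositive property with a non-null member is the age of some graph. -/
theorem HereditaryCompositive.exists_eq_age {P : GraphProperty} (hP : P.HereditaryCompositive)
    (hne : P.HasNonnullMember) : ∃ (V : Type) (H : SimpleGraph V), P = age H := by
  have : Nonempty P.NonnullMember := by
    obtain ⟨W, _, K, _, hK⟩ := hne
    exact ⟨(exists_nonnullMember_iso hK).choose⟩
  -- This is where compositivity enters.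
  have : IsDirectedOrder P.NonnullMember := by
    refine ⟨fun i j => ?_⟩
    obtain ⟨U, _, K, hK, hi, hj⟩ := hP.2 _ _ i.mem j.mem
    have : Nonempty U := ⟨hi.some 0⟩
    obtain ⟨k, ⟨e⟩⟩ := exists_nonnullMember_iso hK
    exact ⟨k, hi.trans ⟨e.toCopy⟩, hj.trans ⟨e.toCopy⟩⟩
  -- Refining `atTop` ensures that a fixed member is contained in almost every factor.
  let U : Ultrafilter P.NonnullMember := Ultrafilter.of Filter.atTop
  refine ⟨_, ultraproduct _ NonnullMember.graph U, eq_of_mem_iff fun {W} _ K => ⟨?_, ?_⟩⟩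
  · intro hK
    cases isEmpty_or_nonempty W
    · exact IsContained.of_isEmpty
    · obtain ⟨i, ⟨e⟩⟩ := exists_nonnullMember_iso hK
      apply isContained_ultraproduct
      filter_upwards [Ultrafilter.of_le _ (Filter.eventually_ge_atTop i)] with j hj
      exact IsContained.trans ⟨e.toCopy⟩ hj
  · intro hK
    obtain ⟨i, hi⟩ := (eventually_isContained_of_ultraproduct _ _ _ hK).exists
    exact hP.1 _ _ hi i.mem

/-! ### Increasing the number of parts of a join -/

/-- Zorn's lemma applies because a finite subgraph of the union of a chain uses finitely many edges,
all present in a single graph of the chain. -/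
theorem ContainsAge.exists_edge_maximal {P : GraphProperty} {V : Type} {H : SimpleGraph V}
    (h : P.ContainsAge H) : ∃ H', H ≤ H' ∧ P.ContainsAge H' ∧
      ∀ u v, u ≠ v → ¬ H'.Adj u v → ¬ P.ContainsAge (H' ⊔ edge u v) := by
  have hub : ∀ c ⊆ {K : SimpleGraph V | P.ContainsAge K}, IsChain (· ≤ ·) c → ∀ K ∈ c,
      ∃ ub ∈ {K : SimpleGraph V | P.ContainsAge K}, ∀ L ∈ c, L ≤ ub := by
    intro c hc hchain K hK
    refine ⟨sSup c, ?_, fun z hz => le_sSup hz⟩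
    rintro W _ G ⟨φ⟩
    have hex : ∀ p : W × W, ∃ L ∈ c, G.Adj p.1 p.2 → L.Adj (φ p.1) (φ p.2) := by
      intro p
      by_cases hp : G.Adj p.1 p.2
      · obtain ⟨L, hL, hadj⟩ := sSup_adj.1 (φ.toHom.map_adj hp)
        exact ⟨L, hL, fun _ => hadj⟩
      · exact ⟨K, hK, fun h => (hp h).elim⟩
    choose L hL hadj using hex
    have : Nonempty c := ⟨⟨K, hK⟩⟩
    have hdir : Directed (· ≤ ·) ((↑) : c → SimpleGraph V) := hchain.directedOn.directed_val
    obtain ⟨M, hM⟩ := hdir.finite_le (fun p => (⟨L p, hL p⟩ : c))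
    exact hc M.2 W _ G ⟨⟨⟨φ, fun {a b} hab => hM (a, b) (hadj (a, b) hab)⟩, φ.injective⟩⟩
  obtain ⟨H', hle, hmax⟩ := zorn_le_nonempty₀ _ hub H h
  refine ⟨H', hle, hmax.prop, fun u v huv hnadj hage => hnadj ?_⟩
  refine hmax.le_of_ge hage le_sup_left ?_
  rw [sup_adj, edge_adj]
  exact Or.inr ⟨Or.inl ⟨rfl, rfl⟩, huv⟩

/-- Adding `uv` to `H` creates a finite graph outside `P`; its image is `T`. The non-edge `uv` is
thus forced in every member of `P` extending `H` on a finite superset of `T`. -/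
theorem exists_finite_forall_not_adj {P : GraphProperty} {V : Type} {H : SimpleGraph V} {u v : V}
    (huv : ¬ P.ContainsAge (H ⊔ edge u v)) (hP : P.Hereditary) :
    ∃ T : Set V, T.Finite ∧ ∀ (T' : Set V) (_ : Finite T'), T ⊆ T' → ∀ K : SimpleGraph T',
      H.induce T' ≤ K → P.Mem K → ∀ hu hv, ¬ K.Adj ⟨u, hu⟩ ⟨v, hv⟩ := by
  simp only [ContainsAge, not_forall] at huv
  obtain ⟨W, _, G, ⟨φ⟩, hG⟩ := huv
  refine ⟨Set.range φ, Set.finite_range _, fun T' _ hT K hle hK hu hv hadj => hG ?_⟩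
  refine hP.mem_of_map hK (fun w => ⟨φ w, hT ⟨w, rfl⟩⟩) ?_ ?_
  · exact fun x y h => φ.injective (Subtype.mk.inj h)
  · intro a b hab
    have := φ.toHom.map_adj hab
    rw [sup_adj, edge_adj] at this
    rcases this with h | ⟨⟨h1, h2⟩ | ⟨h1, h2⟩, -⟩
    · exact hle h
    · convert! hadj
    · convert! hadj.symm

/-- The forcing sets of the non-edges along a walk in the complement are collected, together with
the vertices visited. -/
theorem exists_finite_forall_reachable_compl {P : GraphProperty} {V : Type} {H : SimpleGraph V}
    (hmax : ∀ u v, u ≠ v → ¬ H.Adj u v → ¬ P.ContainsAge (H ⊔ edge u v)) (hP : P.Hereditary)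
    {u v : V} (h : Hᶜ.Reachable u v) :
    ∃ T : Set V, T.Finite ∧ ∀ (T' : Set V) (_ : Finite T'), T ⊆ T' → ∀ K : SimpleGraph T',
      H.induce T' ≤ K → P.Mem K → ∀ hu hv, Kᶜ.Reachable ⟨u, hu⟩ ⟨v, hv⟩ := by
  rw [reachable_iff_reflTransGen] at h
  induction h with
  | refl => exact ⟨∅, Set.finite_empty, fun _ _ _ _ _ _ _ _ => Reachable.refl _⟩
  | @tail y z _ hyz ih =>
    rw [compl_adj] at hyz
    obtain ⟨T, hT, h⟩ := ih
    obtain ⟨S, hS, h'⟩ := exists_finite_forall_not_adj (hmax y z hyz.1 hyz.2) hP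
    refine ⟨insert y (T ∪ S), (hT.union hS).insert y, fun T' _ hT' K hle hK hu hv => ?_⟩
    have hy : y ∈ T' := hT' (Set.mem_insert _ _)
    refine (h T' _ (fun x hx => hT' (Or.inr (Or.inl hx))) K hle hK hu hy).trans
      (Adj.reachable ?_)
    rw [compl_adj]
    exact ⟨fun e => hyz.1 (congrArg Subtype.val e),
      h' T' _ (fun x hx => hT' (Or.inr (Or.inr hx))) K hle hK hy hv⟩

theorem exists_le_isMaximal {P : GraphProperty} {V : Type} [Finite V] {G : SimpleGraph V}
    (hG : P.Mem G) : ∃ K, G ≤ K ∧ P.IsMaximal K := by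
  obtain ⟨K, hle, hK⟩ := Finite.exists_le_maximal (p := fun K : SimpleGraph V => P.Mem K) hG
  refine ⟨K, hle, hK.prop, fun u v huv hnadj hmem => hnadj ?_⟩
  refine hK.le_of_ge hmem le_sup_left ?_
  rw [sup_adj, edge_adj]
  exact Or.inr ⟨Or.inl ⟨rfl, rfl⟩, huv⟩

/-- The join of `H` and a single vertex `none`. -/
def cone {V : Type} (H : SimpleGraph V) : SimpleGraph (Option V) where
  Adj x y := x ≠ y ∧ ∀ u v, x = some u → y = some v → H.Adj u v
  symm := ⟨fun _ _ h => ⟨h.1.symm, fun u v hu hv => (h.2 v u hv hu).symm⟩⟩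
  loopless := ⟨fun _ h => h.1 rfl⟩

theorem isContained_cone {V : Type} (H : SimpleGraph V) : H ⊑ cone H := by
  refine ⟨⟨⟨some, fun {a b} hab => ⟨fun h => hab.ne (Option.some.inj h), ?_⟩⟩,
    Option.some_injective V⟩⟩
  rintro u v ⟨⟩ ⟨⟩
  exact hab

/-- If `H` is edge-maximal with age `P` and the complement of `H` has fewer than `dc(P)`
components, then a vertex may be joined to `H`. -/
theorem containsAge_cone {V : Type} {H : SimpleGraph V} (hproper : (age H).Proper)
    (hmax : ∀ u v, u ≠ v → ¬ H.Adj u v → ¬ (age H).ContainsAge (H ⊔ edge u v))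
    {k : ℕ} (f : V → Fin k) (hf : ∀ u v, f u = f v → Hᶜ.Reachable u v) (hk : k < (age H).dc) :
    (age H).ContainsAge (cone H) := by
  have hP : (age H).Hereditary := (age_hereditaryCompositive H).1
  have hmem : (age H).HasMember := ⟨Empty, inferInstance, ⊥, IsContained.of_isEmpty⟩
  obtain ⟨χ⟩ := hP.mem_top_cliqueNumber hmem hproper
  rintro W _ G ⟨φ⟩
  let S : Set V := some ⁻¹' Set.range φ
  have hS : S.Finite := (Set.finite_range φ).preimage (Option.some_injective V).injOn
  choose T hTfin hT using fun u v (h : f u = f v) =>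
    exists_finite_forall_reachable_compl hmax hP (hf u v h)
  -- The image of `χ` makes `R` large enough for `M*`; the sets `T u v h` keep vertices of `S` with
  -- equal label in one complement component of every extension in the age.
  let R : Set V := S ∪ Set.range χ ∪ ⋃ u ∈ S, ⋃ v ∈ S, ⋃ h : f u = f v, T u v h
  have hR : R.Finite := by
    refine (hS.union (Set.finite_range χ)).union ?_
    exact hS.biUnion fun u _ => hS.biUnion fun v _ => Set.finite_iUnion fun h => hTfin u v h
  have : Finite R := hR
  have hSR : S ⊆ R := fun x hx => Or.inl (Or.inl hx)
  obtain ⟨K, hle, hK⟩ := exists_le_isMaximal (P := age H) (G := H.induce R) ⟨Copy.induce _ _⟩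
  have hcard : (age H).cliqueNumber ≤ Nat.card R := by
    have := Nat.card_le_card_of_injective
      (fun i => (⟨χ i, Or.inl (Or.inr ⟨i, rfl⟩)⟩ : R))
      fun a b h => χ.injective (Subtype.mk.inj h)
    simpa using this
  have hdc : (age H).dc ≤ graphDc K := dc_le ⟨hK, hcard⟩
  rw [graphDc_eq_card_connectedComponent] at hdc
  -- If every complement component of `K` met `S`, choosing a vertex of `S` in each would give
  -- distinct labels in `Fin k`, hence at most `k < dc` components.
  obtain ⟨r, hr⟩ : ∃ r : R, ∀ s : R, s.1 ∈ S → ¬ Kᶜ.Reachable s r := by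
    by_contra! hcon
    have hex : ∀ c : Kᶜ.ConnectedComponent, ∃ s : R, s.1 ∈ S ∧ Kᶜ.connectedComponentMk s = c := by
      intro c
      induction c using ConnectedComponent.ind with
      | h r =>
        obtain ⟨s, hs, hsr⟩ := hcon r
        exact ⟨s, hs, ConnectedComponent.eq.2 hsr⟩
    choose s hs hsc using hex
    have := Nat.card_le_card_of_injective (fun c => f (s c)) fun c d hcd => by
      rw [← hsc c, ← hsc d, ConnectedComponent.eq]
      refine hT _ _ hcd R _ ?_ K hle hK.1 _ _
      exact fun x hx => Or.inr (Set.mem_iUnion₂.2 ⟨s c, hs c, Set.mem_iUnion₂.2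
        ⟨s d, hs d, Set.mem_iUnion.2 ⟨hcd, hx⟩⟩⟩)
    rw [Nat.card_fin] at this
    omega
  have hrS : ∀ s : R, s.1 ∈ S → K.Adj s r := by
    intro s hs
    by_contra hadj
    have hne : s ≠ r := by
      rintro rfl
      exact hr s hs (Reachable.refl _)
    exact hr s hs (Adj.reachable ((compl_adj _ _ _).2 ⟨hne, hadj⟩))
  have hex : ∀ w, ∃ t : R, (∀ u, φ w = some u → t.1 = u) ∧ (φ w = none → t = r) := by
    intro w
    rcases hw : φ w with _ | u
    · exact ⟨r, by simp, by simp⟩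
    · exact ⟨⟨u, hSR ⟨w, hw⟩⟩, by simp, by simp⟩
  choose ψ hψ hψ' using hex
  have hψS : ∀ w u, φ w = some u → (ψ w).1 ∈ S := fun w u h => by
    rw [hψ w u h]
    exact ⟨w, h⟩
  -- The apex `none` is sent to `r`, which `K` joins to all of `S`; other vertices stay in place.
  refine hP.mem_of_map hK.1 ψ ?_ ?_
  · intro a b hab
    apply φ.injective
    change φ a = φ b
    rcases ha : φ a with _ | u <;> rcases hb : φ b with _ | v
    · rfl
    · exact (((hrS _ (hψS b v hb)).ne (hab.symm.trans (hψ' a ha)))).elim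
    · exact (((hrS _ (hψS a u ha)).ne (hab.trans (hψ' b hb)))).elim
    · rw [← hψ a u ha, ← hψ b v hb, hab]
  · intro a b hab
    have hadj : (cone H).Adj (φ a) (φ b) := φ.toHom.map_adj hab
    rcases ha : φ a with _ | u <;> rcases hb : φ b with _ | v
    · exact (hadj.1 (ha.trans hb.symm)).elim
    · rw [hψ' a ha]
      exact (hrS _ (hψS b v hb)).symm
    · rw [hψ' b hb]
      exact hrS _ (hψS a u ha)
    · apply hle
      change H.Adj (ψ a).1 (ψ b).1
      rw [hψ a u ha, hψ b v hb]
      exact hadj.2 u v ha hb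

/-- `P` is the age of a join of `k` non-null graphs. -/
def IsAgeOfJoin (P : GraphProperty) (k : ℕ) : Prop :=
  ∃ (V : Type) (H : SimpleGraph V) (f : V → Fin k), Function.Surjective f ∧
    (∀ u v, f u ≠ f v → H.Adj u v) ∧ P = age H

theorem IsAgeOfJoin.succ {P : GraphProperty} (hproper : P.Proper) {k : ℕ} (hk : k < P.dc)
    (h : P.IsAgeOfJoin k) : P.IsAgeOfJoin (k + 1) := by
  classical
  obtain ⟨V, H₀, f, hsurj, hf₀, rfl⟩ := h
  obtain ⟨H, hle, hage, hmax⟩ := (containsAge_age H₀).exists_edge_maximal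
  have heq : age H₀ = age H := hage.age_eq (.of_le hle)
  have hf : ∀ u v, f u ≠ f v → H.Adj u v := fun u v h => hle (hf₀ u v h)
  rw [heq] at hmax hk hproper ⊢
  by_cases hconn : ∀ u v, f u = f v → Hᶜ.Reachable u v
  · have hcone := containsAge_cone hproper hmax f hconn hk
    refine ⟨Option V, cone H, fun o => o.elim (Fin.last k) (fun v => (f v).castSucc), ?_, ?_,
      hcone.age_eq (isContained_cone H)⟩
    · intro i
      induction i using Fin.lastCases with
      | last => exact ⟨none, rfl⟩
      | cast i =>
        obtain ⟨v, rfl⟩ := hsurj i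
        exact ⟨some v, rfl⟩
    · intro x y hxy
      refine ⟨fun e => hxy (by rw [e]), ?_⟩
      rintro u v rfl rfl
      exact hf u v fun e => hxy (congrArg Fin.castSucc e)
  · push Not at hconn
    obtain ⟨a, b, hab, hnr⟩ := hconn
    -- The complement component of `a` becomes the new part. It lies inside the fibre of `a`, where
    -- `b` remains, so no old part is emptied.
    refine ⟨V, H, fun x => if Hᶜ.Reachable a x then Fin.last k else (f x).castSucc, ?_, ?_, rfl⟩
    · intro i
      induction i using Fin.lastCases with
      | last => exact ⟨a, if_pos (Reachable.refl _)⟩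
      | cast i =>
        by_cases hi : f b = i
        · exact ⟨b, by simp [hnr, hi]⟩
        · obtain ⟨v, rfl⟩ := hsurj i
          have hcon : ∀ x, Hᶜ.Reachable a x → f x = f a := by
            intro x hx
            rw [reachable_iff_reflTransGen] at hx
            induction hx with
            | refl => rfl
            | @tail y z _ hyz ih =>
              rw [compl_adj] at hyz
              by_contra hz
              exact hyz.2 (hf y z fun e => hz (e.symm.trans ih))
          refine ⟨v, if_neg fun hv => hi ?_⟩
          rw [hcon v hv, hab]
    · intro u v huv
      by_contra hadj
      have hne : u ≠ v := fun e => huv (by rw [e])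
      have huv' : Hᶜ.Reachable u v := Adj.reachable ((compl_adj _ _ _).2 ⟨hne, hadj⟩)
      have hiff : Hᶜ.Reachable a u ↔ Hᶜ.Reachable a v :=
        ⟨fun h => h.trans huv', fun h => h.trans huv'.symm⟩
      have hfuv : f u = f v := by
        by_contra h
        exact hadj (hf u v h)
      exact huv (by simp only [hiff, hfuv])

theorem isAgeOfJoin_dc {P : GraphProperty} (hP : P.HereditaryCompositive)
    (hne : P.HasNonnullMember) (hproper : P.Proper) : P.IsAgeOfJoin P.dc := by
  have key : ∀ k, 1 ≤ k → k ≤ P.dc → P.IsAgeOfJoin k := by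
    intro k hk
    induction k, hk using Nat.le_induction with
    | base =>
      intro _
      obtain ⟨V, H, rfl⟩ := hP.exists_eq_age hne
      have : Nonempty V := by
        obtain ⟨W, _, G, ⟨w⟩, ⟨φ⟩⟩ := hne
        exact ⟨φ w⟩
      exact ⟨V, H, fun _ => 0, fun i => ⟨Classical.arbitrary V, Subsingleton.elim _ _⟩,
        fun u v h => (h rfl).elim, rfl⟩
    | succ k _ ih => exact fun h => (ih (by omega)).succ hproper (by omega)
  exact key _ (one_le_dc hP.1 hne hproper) le_rfl

theorem exists_prod_eq_of_hasNonnullMember {P : GraphProperty} (hP : P.HereditaryCompositive)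
    (hne : P.HasNonnullMember) (hproper : P.Proper) :
    ∃ Q : Fin P.dc → GraphProperty, P = prod Q ∧
      ∀ i, (Q i).HereditaryCompositive ∧ (Q i).HasNonnullMember := by
  obtain ⟨V, H, f, hsurj, hf, h⟩ := isAgeOfJoin_dc hP hne hproper
  refine ⟨fun i => age (H.induce (f ⁻¹' {i})), h.trans (age_eq_prod H f hf), fun i => ?_⟩
  obtain ⟨v, hv⟩ := hsurj i
  have : Nonempty (f ⁻¹' {i}) := ⟨⟨v, hv⟩⟩
  exact ⟨age_hereditaryCompositive _, age_hasNonnullMember _⟩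

end GraphProperty

namespace GraphProperty

/-! ### Additive properties -/

/-- The disjoint union of countably many copies of `H`. -/
def copies {V : Type} (H : SimpleGraph V) : SimpleGraph (ℕ × V) where
  Adj x y := x.1 = y.1 ∧ H.Adj x.2 y.2
  symm := ⟨fun _ _ h => ⟨h.1.symm, h.2.symm⟩⟩
  loopless := ⟨fun _ h => h.2.ne rfl⟩

/-- One graph is placed in the even-numbered copies and the other in the odd-numbered ones. -/
theorem age_copies_additive {V : Type} (H : SimpleGraph V) : (age (copies H)).Additive := by
  rintro A B _ _ G K ⟨φ⟩ ⟨ψ⟩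
  refine ⟨⟨⟨Sum.elim (fun a => (2 * (φ a).1, (φ a).2)) (fun b => (2 * (ψ b).1 + 1, (ψ b).2)),
    fun {x y} hxy => ?_⟩, fun x y hxy => ?_⟩⟩
  · rcases x with x | x <;> rcases y with y | y
    · have h : (copies H).Adj (φ x) (φ y) := φ.toHom.map_adj hxy
      exact ⟨congrArg (2 * ·) h.1, h.2⟩
    · exact (Bool.false_ne_true hxy).elim
    · exact (Bool.false_ne_true hxy).elim
    · have h : (copies H).Adj (ψ x) (ψ y) := ψ.toHom.map_adj hxy
      exact ⟨congrArg (2 * · + 1) h.1, h.2⟩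
  · rcases x with x | x <;> rcases y with y | y <;>
      obtain ⟨h1, h2⟩ := Prod.mk.inj hxy
    · exact congrArg _ (φ.injective (Prod.ext (show (φ x).1 = (φ y).1 by omega) h2))
    · omega
    · omega
    · exact congrArg _ (ψ.injective (Prod.ext (show (ψ x).1 = (ψ y).1 by omega) h2))

theorem isContained_sum_induce_compl {V : Type} (G : SimpleGraph V) (A : Set V)
    (hA : ∀ u ∈ A, ∀ v ∉ A, ¬ G.Adj u v) : G ⊑ G.induce A ⊕g G.induce Aᶜ := by
  classical
  refine ⟨⟨⟨fun v => if h : v ∈ A then Sum.inl ⟨v, h⟩ else Sum.inr ⟨v, h⟩, fun {x y} hxy => ?_⟩,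
    fun x y hxy => ?_⟩⟩
  · by_cases hx : x ∈ A <;> by_cases hy : y ∈ A
    · simpa [hx, hy] using hxy
    · exact (hA x hx y hy hxy).elim
    · exact (hA y hy x hx hxy.symm).elim
    · simpa [hx, hy] using hxy
  · by_cases hx : x ∈ A <;> by_cases hy : y ∈ A <;> simp_all

/-- Induction on a bound for the indices of the copies used: the part in the last copy is split off
as a disjoint summand. -/
theorem ContainsAge.copies {P : GraphProperty} (hP : P.Hereditary) (hadd : P.Additive)
    (hne : P.HasMember) {V : Type} {H : SimpleGraph V} (h : P.ContainsAge H) :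
    P.ContainsAge (copies H) := by
  have key : ∀ (N : ℕ) (W : Type) (_ : Finite W) (G : SimpleGraph W)
      (φ : Copy G (GraphProperty.copies H)), (∀ w, (φ w).1 < N) → P.Mem G := by
    intro N
    induction N with
    | zero =>
      intro W _ G φ hφ
      have : IsEmpty W := ⟨fun w => by simpa using hφ w⟩
      exact hP.mem_of_isEmpty hne G
    | succ N ih =>
      intro W _ G φ hφ
      let A : Set W := {w | (φ w).1 < N}
      have hB : ∀ w ∉ A, (φ w).1 = N := fun w hw => by
        have := hφ w
        simp only [A, Set.mem_ofPred_eq] at hw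
        omega
      have hadj : ∀ {a b}, G.Adj a b → (GraphProperty.copies H).Adj (φ a) (φ b) :=
        fun h => φ.toHom.map_adj h
      refine hP _ _ (isContained_sum_induce_compl G A ?_) (hadd _ _ ?_ ?_)
      · intro u hu v hv huv
        have h1 : (φ u).1 = (φ v).1 := (hadj huv).1
        have h2 : (φ u).1 < N := hu
        have h3 := hB v hv
        omega
      · exact ih A _ _ (φ.comp (Copy.induce G A)) fun w => w.2
      · refine h _ _ _ ⟨⟨⟨fun w => (φ w.1).2, fun hab => (hadj hab).2⟩, fun x y hxy => ?_⟩⟩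
        exact Subtype.ext (φ.injective
          (Prod.ext ((hB x.1 x.2).trans (hB y.1 y.2).symm) hxy))
  rintro W _ G ⟨φ⟩
  obtain ⟨N, hN⟩ := (Set.finite_range fun w => (φ w).1).bddAbove
  exact key (N + 1) W _ G φ fun w => Nat.lt_succ_of_le (hN ⟨w, rfl⟩)

/-- A graph whose finite subgraphs belong to a product of finitely many hereditary properties can
be partitioned accordingly. -/
theorem ContainsAge.exists_partition {ι : Type} [Finite ι] {Q : ι → GraphProperty}
    (hQ : ∀ i, (Q i).Hereditary) (hne : ∀ i, (Q i).HasMember) {V : Type} {H : SimpleGraph V}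
    (h : (prod Q).ContainsAge H) :
    ∃ f : V → ι, ∀ i, (Q i).ContainsAge (H.induce (f ⁻¹' {i})) := by
  classical
  choose g hg using fun T : Finset V =>
    exists_forall_mem_of_prod hQ hne (h T _ (H.induce (T : Set V)) ⟨Copy.induce _ _⟩)
  -- Compactness: on each finite set, `χ` agrees with the partition `g t` for some finite `t`
  -- containing that set.
  obtain ⟨χ, hχ⟩ := Finset.rado_selection_subtype (β := fun _ : V => ι) g
  refine ⟨χ, fun i => ?_⟩
  rintro W _ G ⟨φ⟩
  have hfin : (Set.range fun w => (φ w).1).Finite := Set.finite_range _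
  obtain ⟨t, hst, ht⟩ := hχ hfin.toFinset
  have hmem : ∀ w, (φ w).1 ∈ hfin.toFinset := fun w => hfin.mem_toFinset.2 ⟨w, rfl⟩
  refine Hereditary.mem_of_map (hQ i) (hg t i)
    (fun w => ⟨⟨(φ w).1, hst (hmem w)⟩, ?_⟩) ?_ ?_
  · exact (ht ⟨_, hmem w⟩).symm.trans (φ w).2
  · intro x y hxy
    have hxy : (φ x).1 = (φ y).1 := congrArg (fun z => z.1.1) hxy
    exact φ.injective (Subtype.ext hxy)
  · exact fun a b hab => φ.toHom.map_adj hab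

/-- Each vertex `v` gets the label that its copies `(n, v)` carry for almost all `n`. For finitely
many vertices, infinitely many `n` carry all the right labels at once, and a finite graph can be
rerouted into those copies. -/
theorem exists_partition_copies {ι : Type} [Finite ι] {Q : ι → GraphProperty}
    (hQ : ∀ i, (Q i).Hereditary) (hne : ∀ i, (Q i).HasMember) {V : Type} {H : SimpleGraph V}
    (h : (prod Q).ContainsAge (copies H)) :
    ∃ f : V → ι, ∀ i, (Q i).ContainsAge (copies (H.induce (f ⁻¹' {i}))) := by
  obtain ⟨ψ, hψ⟩ := h.exists_partition hQ hne
  have hlim : ∀ v, ∃ i, ∀ᶠ n in (Filter.hyperfilter ℕ : Filter ℕ), ψ (n, v) = i := by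
    intro v
    exact Ultrafilter.eventually_exists_iff.1 (.of_forall fun n => ⟨ψ (n, v), rfl⟩)
  choose f hf using hlim
  refine ⟨f, fun i => ?_⟩
  rintro W _ G ⟨θ⟩
  have hev : ∀ᶠ n in (Filter.hyperfilter ℕ : Filter ℕ), ∀ w, ψ (n, (θ w).2.1) = i :=
    Filter.eventually_all.2 fun w => (hf (θ w).2.1).mono fun n hn => hn.trans (θ w).2.2
  have hinf : {n | ∀ w, ψ (n, (θ w).2.1) = i}.Infinite :=
    fun hfin => Filter.notMem_hyperfilter_of_finite hfin hev
  let e := hinf.natEmbedding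
  refine hψ i W _ G ⟨⟨⟨fun w => ⟨((e (θ w).1).1, (θ w).2.1), (e (θ w).1).2 w⟩,
    fun {a b} hab => ?_⟩, fun a b hab => ?_⟩⟩
  · have hadj : (copies (H.induce (f ⁻¹' {i}))).Adj (θ a) (θ b) := θ.toHom.map_adj hab
    exact ⟨congrArg (fun n => (e n).1) hadj.1, hadj.2⟩
  · obtain ⟨h1, h2⟩ := Prod.mk.inj (Subtype.mk.inj hab)
    exact θ.injective (Prod.ext (e.injective (Subtype.ext h1)) (Subtype.ext h2))

/-- The ages of the copied fibres of `H` lie inside the factors `Q i` of an arbitrary factorisation,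
while their product contains the age of `H`; so that product is squeezed to equal `P`. -/
theorem exists_prod_eq_of_additive {P : GraphProperty} (hP : P.HereditaryCompositive)
    (hne : P.HasNonnullMember) (hproper : P.Proper) (hadd : P.Additive) :
    ∃ Q : Fin P.dc → GraphProperty, P = prod Q ∧
      ∀ i, ((Q i).HereditaryCompositive ∧ (Q i).HasNonnullMember) ∧ (Q i).Additive := by
  obtain ⟨Q, hPQ, hQ⟩ := exists_prod_eq_of_hasNonnullMember hP hne hproper
  obtain ⟨V, H, hPH⟩ := hP.exists_eq_age hne
  have hage : P.ContainsAge H := by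
    rw [hPH]
    exact containsAge_age H
  have hcopies : (prod Q).ContainsAge (copies H) := by
    rw [← hPQ]
    exact hage.copies hP.1 hadd hne.hasMember
  obtain ⟨f, hf⟩ := exists_partition_copies (fun i => (hQ i).1.1)
    (fun i => (hQ i).2.hasMember) hcopies
  -- Were label `i` unused, a largest clique could be extended by one vertex labelled `i`, a
  -- one-vertex graph being in `Q i`; this gives a clique of `c(P) + 1` vertices in `P`.
  have hsurj : Function.Surjective f := by
    intro i
    by_contra! hi
    have hPher : P.Hereditary := hP.1
    obtain ⟨χ⟩ : (⊤ : SimpleGraph (Fin P.cliqueNumber)) ⊑ H :=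
      (mem_iff_of_eq hPH _).1 (hPher.mem_top_cliqueNumber hne.hasMember hproper)
    have hmem : P.Mem (⊤ : SimpleGraph (Option (Fin P.cliqueNumber))) := by
      refine (mem_iff_of_eq hPQ _).2 ?_
      refine prod_mem_of_forall (fun o => o.elim i fun a => f (χ a)) fun j => ?_
      by_cases hj : j = i
      · subst hj
        refine Hereditary.mem_of_card_le_one (hQ j).1.1 (hQ j).2 _ ?_
        rw [Finite.card_le_one_iff_subsingleton]
        have hnone : ∀ x : ((fun o : Option (Fin P.cliqueNumber) =>
            o.elim j fun a => f (χ a)) ⁻¹' {j} : Set _), x.1 = none := by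
          rintro ⟨_ | a, hx⟩
          · rfl
          · exact (hi _ hx).elim
        exact ⟨fun x y => Subtype.ext ((hnone x).trans (hnone y).symm)⟩
      · have hsome : ∀ x : ((fun o : Option (Fin P.cliqueNumber) =>
            o.elim i fun a => f (χ a)) ⁻¹' {j} : Set _), ∃ a, x.1 = some a ∧ f (χ a) = j := by
          rintro ⟨_ | a, hx⟩
          · exact (hj (Eq.symm hx)).elim
          · exact ⟨a, rfl, hx⟩
        choose s hs hs' using hsome
        refine hf j _ _ _ ⟨⟨⟨fun x => (0, ⟨χ (s x), hs' x⟩), fun {x y} hxy => ⟨rfl, ?_⟩⟩,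
          fun x y hxy => ?_⟩⟩
        · refine χ.toHom.map_adj ?_
          rw [top_adj]
          intro hst
          exact hxy.ne (Subtype.ext ((hs x).trans (hst ▸ (hs y).symm)))
        · have := χ.injective (Subtype.mk.inj (Prod.mk.inj hxy).2)
          exact Subtype.ext ((hs x).trans (this ▸ (hs y).symm))
    have := hPher.card_le_cliqueNumber hproper hmem
    rw [Finite.card_option, Nat.card_fin] at this
    omega
  refine ⟨fun i => age (copies (H.induce (f ⁻¹' {i}))), ?_, fun i => ⟨⟨?_, ?_⟩, ?_⟩⟩
  · refine eq_of_mem_iff fun {W} _ G => ⟨fun hG => ?_, ?_⟩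
    · rw [hPH] at hG
      obtain ⟨φ⟩ := hG
      refine ⟨f ∘ φ, fun i _ => ⟨⟨⟨fun x => (0, ⟨φ x.1, x.2⟩),
        fun hxy => ⟨rfl, φ.toHom.map_adj hxy⟩⟩, fun x y hxy => ?_⟩⟩⟩
      exact Subtype.ext (φ.injective (Subtype.mk.inj (Prod.mk.inj hxy).2))
    · rintro ⟨g, hg⟩
      rw [hPQ]
      exact ⟨g, fun i hi => hf i _ _ _ (hg i hi)⟩
  · exact age_hereditaryCompositive _
  · obtain ⟨v, hv⟩ := hsurj i
    have : Nonempty (f ⁻¹' {i}) := ⟨⟨v, hv⟩⟩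
    exact age_hasNonnullMember _
  · exact age_copies_additive _

/-! ### The property consisting of null graphs only -/

theorem dc_eq_zero {P : GraphProperty} (hP : P.Hereditary) (hne : P.HasMember)
    (hproper : P.Proper) (hnull : ¬ P.HasNonnullMember) : P.dc = 0 := by
  obtain ⟨V, _, G, hG, hdc⟩ := exists_graphDc_eq_dc hP hne hproper
  have : IsEmpty V := not_nonempty_iff.1 fun h => hnull ⟨V, _, G, h, hG.1.1⟩
  rw [← hdc, graphDc_eq_card_connectedComponent]
  have : IsEmpty Gᶜ.ConnectedComponent :=
    ⟨fun c => isEmptyElim c.nonempty_supp.some⟩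
  exact Nat.card_of_isEmpty

theorem eq_prod_of_isEmpty {P : GraphProperty} (hP : P.Hereditary) (hne : P.HasMember)
    (hnull : ¬ P.HasNonnullMember) {ι : Type} [IsEmpty ι] (Q : ι → GraphProperty) :
    P = prod Q := by
  refine eq_of_mem_iff fun {V} _ G => ⟨fun hG => ?_, ?_⟩
  · have : IsEmpty V := not_nonempty_iff.1 fun h => hnull ⟨V, _, G, h, hG⟩
    exact ⟨isEmptyElim, isEmptyElim⟩
  · rintro ⟨f, -⟩
    have : IsEmpty V := f.isEmpty
    exact hP.mem_of_isEmpty hne G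

end GraphProperty

theorem mainTheorem3 (P : GraphProperty) (hP : P.HereditaryCompositive)
    (hne : P.HasMember) (hproper : P.Proper) :
    (∃ Q : Fin P.dc → GraphProperty,
      P = GraphProperty.prod Q ∧
        ∀ i, (Q i).HereditaryCompositive ∧ (Q i).HasNonnullMember ∧ (Q i).Indecomposable) ∧
    (∀ Q : Fin P.dc → GraphProperty,
      P = GraphProperty.prod Q →
        (∀ i, (Q i).HereditaryCompositive ∧ (Q i).HasNonnullMember) →
          ∀ i, (Q i).Indecomposable) ∧
    (P.Additive →
      ∃ Q : Fin P.dc → GraphProperty,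
        P = GraphProperty.prod Q ∧
          ∀ i, (Q i).HereditaryCompositive ∧ (Q i).HasNonnullMember ∧ (Q i).Indecomposable ∧
            (Q i).Additive) := by
  have hind : ∀ Q : Fin P.dc → GraphProperty, P = GraphProperty.prod Q →
      (∀ i, (Q i).HereditaryCompositive ∧ (Q i).HasNonnullMember) →
        ∀ i, (Q i).Indecomposable :=
    fun Q h hQ => GraphProperty.indecomposable_of_prod hproper h hQ
  by_cases hnull : P.HasNonnullMember
  · refine ⟨?_, hind, fun hadd => ?_⟩
    · obtain ⟨Q, h, hQ⟩ := GraphProperty.exists_prod_eq_of_hasNonnullMember hP hnull hproper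
      exact ⟨Q, h, fun i => ⟨(hQ i).1, (hQ i).2, hind Q h hQ i⟩⟩
    · obtain ⟨Q, h, hQ⟩ := GraphProperty.exists_prod_eq_of_additive hP hnull hproper hadd
      exact ⟨Q, h, fun i => ⟨(hQ i).1.1, (hQ i).1.2, hind Q h (fun i => (hQ i).1) i, (hQ i).2⟩⟩
  · have hdc : P.dc = 0 := GraphProperty.dc_eq_zero hP.1 hne hproper hnull
    have : IsEmpty (Fin P.dc) := by
      rw [hdc]
      infer_instance
    -- The index type is empty, so the family is arbitrary.
    have h := GraphProperty.eq_prod_of_isEmpty hP.1 hne hnull fun _ : Fin P.dc => P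
    exact ⟨⟨_, h, isEmptyElim⟩, hind, fun _ => ⟨_, h, isEmptyElim⟩⟩
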